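/- Theorem 1.2. For a group $G$ let $[G,G]$ be its commutator subgroup and $Z(G)$ its center, and let $\circ_G\colon G/Z(G)\times G/Z(G)\to [G,G]$, $(xZ(G),yZ(G))\mapsto [x,y]$, be its commutation map. Groups $G$ and $H$ are isoclinic if there are isomorphisms $f\colon G/Z(G)\to H/Z(H)$ and $\hat f\colon [G,G]\to[H,H]$ with $f(u)\circ_H f(v)=\hat f(u\circ_G v)$ for all $u,v\in G/Z(G)$. A central decomposition of $G$ is a set $\mathcal H$ of subgroups generating $G$ such that, for every $H\in\mathcal H$, one has $G\neq\langle \mathcal H\setminus\{H\}\rangle$ and $[H,\langle\mathcal H\setminus\{H\}\rangle]=1$; and $G$ is centrally indecomposable if $\{G\}$ is its only central decomposition. A centrally indecomposable group $G$ is here said to have genus $2$ over a field $k$ if $G/Z(G)$ and $[G,G]$ carry structures of finite-dimensional $k$-vector spaces, extending their group structures, such that $\dim_k [G,G]=2$ and $\circ_G$ is $k$-bilinear. (If $k$ is the largest ring over which $\circ_G$ is bilinear, the centroid of $\circ_G$, this says that $[G,G]$ has rank $2$ over the centroid; it is not required that $k$ be the whole centroid.) Let $p$ be a prime, $k$ a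 field, and $G$ a centrally indecomposable $p$-group of genus $2$ over $k$. Then $G$ is isoclinic to one of the following groups. (i) (Sloped case) A quotient $H/L$ of a Heisenberg group $$H=\left\{\begin{bmatrix}1&e&w\\0&1&f\\0&0&1\end{bmatrix} : e,f,w\in R\right\},\qquad R=k[x]/(a(x)^c),$$ with $a(x)\in k[x]$ irreducible and $c\geq 1$, by a subgroup $L\leq [H,H]$ consisting of the matrices with $e=f=0$ and $w\in L_0$, where $L_0$ is a $k$-subspace of codimension $2$ in $R\cong k^{n}$, $n=c\deg a(x)$. (ii) (Flat case) For some $m\geq 1$, the matrix group $$H^{\flat}=\left\{\left[\begin{array}{c|c|c} I_2 & \begin{array}{cccc} e_1&\cdots&e_m&0\\ 0&e_1&\cdots&e_m\end{array} & \begin{array}{c} w_1\\w_2\end{array}\\ \hline & I_{m+1} & \begin{array}{c} f_0\\ \vdots\\ f_m\end{array}\\ \hline & & 1\end{array}\right] : e_i,f_j,w_\ell\in k\right\}.$$ -/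

import Mathlib

open Polynomial
open scoped commutatorElement

/-! ### Commutation and isoclinism -/

theorem commutator_mul_central {G : Type*} [Group G] {z t : G} (hz : z ∈ Subgroup.center G)
    (ht : t ∈ Subgroup.center G) (a b : G) : ⁅a * z, b * t⁆ = ⁅a, b⁆ := by
  rw [Subgroup.mem_center_iff] at hz ht
  have h1 : ∀ g, z * g * z⁻¹ = g := fun g => by rw [← hz g]; group
  have h2 : ∀ g, t * g * t⁻¹ = g := fun g => by rw [← ht g]; group
  calc ⁅a * z, b * t⁆ = a * (z * (b * t) * z⁻¹) * a⁻¹ * t⁻¹ * b⁻¹ := by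
        rw [commutatorElement_def]; group
    _ = a * b * (t * a⁻¹ * t⁻¹) * b⁻¹ := by rw [h1]; group
    _ = ⁅a, b⁆ := by rw [h2, commutatorElement_def]

/-- The commutation map `G/Z(G) × G/Z(G) → [G, G]`, sending `(x Z(G), y Z(G))` to `[x, y]`. -/
def commutation (G : Type*) [Group G] (x y : G ⧸ Subgroup.center G) : commutator G :=
  Quotient.liftOn₂' x y
    (fun a b => ⟨⁅a, b⁆, by
      rw [commutator_def]
      exact Subgroup.commutator_mem_commutator (Subgroup.mem_top a) (Subgroup.mem_top b)⟩)
    (by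
      intro a b a' b' ha hb
      rw [QuotientGroup.leftRel_apply] at ha hb
      apply Subtype.ext
      have h := commutator_mul_central ha hb a b
      rw [mul_inv_cancel_left, mul_inv_cancel_left] at h
      exact h.symm)

/-- Two groups are isoclinic: there are isomorphisms `G/Z(G) ≅ H/Z(H)` and `[G, G] ≅ [H, H]`
that carry the commutation map of `G` to that of `H`. -/
def Isoclinic (G H : Type*) [Group G] [Group H] : Prop :=
  ∃ (f : (G ⧸ Subgroup.center G) ≃* (H ⧸ Subgroup.center H)) (f' : commutator G ≃* commutator H),
    ∀ x y : G ⧸ Subgroup.center G, commutation H (f x) (f y) = f' (commutation G x y)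

/-! ### Central decompositions -/

/-- A central decomposition of `G`: a set of subgroups that generates `G`, such that for each
member `H` the remaining members do not generate `G`, and commute with `H`. -/
def IsCentralDecomposition {G : Type*} [Group G] (S : Set (Subgroup G)) : Prop :=
  sSup S = ⊤ ∧ ∀ H ∈ S, sSup (S \ {H}) ≠ ⊤ ∧ ⁅H, sSup (S \ {H})⁆ = ⊥

/-- `G` is centrally indecomposable: `{G}` is its one and only central decomposition. -/
def IsCentrallyIndecomposable (G : Type*) [Group G] : Prop :=
  ∀ S : Set (Subgroup G), IsCentralDecomposition S ↔ S = {⊤}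

/-! ### Genus 2 over a field -/

/-- The commutator structure of `G` is encoded over the field `k`, with commutator subgroup of
dimension `2`: the groups `G/Z(G)` and `[G, G]` carry `k`-vector space structures, given here by
additive coordinate isomorphisms with `k ^ d` and `k ^ 2`, for which commutation is a `k`-bilinear
map `k ^ d × k ^ d → k ^ 2`. Then `G` is nilpotent of class `2`.
If the field `k` is the centroid of the commutation map (the largest ring over which it is
bilinear), this says that `[G, G]` has rank `2` over the centroid. That `k` be the whole
centroid is not required. -/
def HasGenusTwoOver (k : Type*) [Field k] (G : Type*) [Group G] : Prop :=
  ∃ (d : ℕ) (eV : Additive (G ⧸ Subgroup.center G) ≃+ (Fin d → k))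
    (eW : Additive (commutator G) ≃+ (Fin 2 → k))
    (B : (Fin d → k) →ₗ[k] (Fin d → k) →ₗ[k] (Fin 2 → k)),
    ∀ x y : G ⧸ Subgroup.center G,
      eW (Additive.ofMul (commutation G x y)) =
        B (eV (Additive.ofMul x)) (eV (Additive.ofMul y))

/-! ### Heisenberg groups and their central quotients -/

/-- The matrix with rows `(1, e, w)`, `(0, 1, f)`, `(0, 0, 1)`. -/
def heisenbergMatrix {R : Type*} [CommRing R] (e f w : R) : Matrix (Fin 3) (Fin 3) R :=
  !![1, e, w; 0, 1, f; 0, 0, 1]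

theorem heisenbergMatrix_mul {R : Type*} [CommRing R] (e f w e' f' w' : R) :
    heisenbergMatrix e f w * heisenbergMatrix e' f' w' =
      heisenbergMatrix (e + e') (f + f') (w + w' + e * f') := by
  ext i j
  fin_cases i <;> fin_cases j <;>
    simp [heisenbergMatrix, Matrix.mul_apply, Fin.sum_univ_three] <;> ring

theorem heisenbergMatrix_zero {R : Type*} [CommRing R] :
    heisenbergMatrix (0 : R) 0 0 = 1 := by
  ext i j
  fin_cases i <;> fin_cases j <;> simp [heisenbergMatrix]

/-- The Heisenberg group over a commutative ring `R`, as a group of matrices. -/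
def heisenberg (R : Type*) [CommRing R] : Subgroup (GL (Fin 3) R) where
  carrier := {g | ∃ e f w : R, (g : Matrix (Fin 3) (Fin 3) R) = heisenbergMatrix e f w}
  mul_mem' := by
    rintro g h ⟨e, f, w, hg⟩ ⟨e', f', w', hh⟩
    exact ⟨_, _, _, by rw [Units.val_mul, hg, hh, heisenbergMatrix_mul]⟩
  one_mem' := ⟨0, 0, 0, by rw [heisenbergMatrix_zero]; rfl⟩
  inv_mem' := by
    rintro g ⟨e, f, w, hg⟩
    refine ⟨-e, -f, -w + e * f, ?_⟩
    apply Units.inv_eq_of_mul_eq_one_right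
    rw [hg, heisenbergMatrix_mul, ← heisenbergMatrix_zero]
    congr 1 <;> ring

/-- For an additive subgroup `L` of `R`, the subgroup of the Heisenberg group of `R` that consists
of the matrices with `e = f = 0` and `w ∈ L`. -/
def heisenbergCentral {R : Type*} [CommRing R] (L : AddSubgroup R) : Subgroup (heisenberg R) where
  carrier := {g | ∃ w ∈ L, (g.1 : Matrix (Fin 3) (Fin 3) R) = heisenbergMatrix 0 0 w}
  mul_mem' := by
    rintro g h ⟨w, hw, hg⟩ ⟨w', hw', hh⟩
    refine ⟨w + w', L.add_mem hw hw', ?_⟩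
    rw [Subgroup.coe_mul, Units.val_mul, hg, hh, heisenbergMatrix_mul]
    simp
  one_mem' := ⟨0, L.zero_mem, by rw [heisenbergMatrix_zero]; rfl⟩
  inv_mem' := by
    rintro g ⟨w, hw, hg⟩
    refine ⟨-w, L.neg_mem hw, ?_⟩
    rw [Subgroup.coe_inv]
    apply Units.inv_eq_of_mul_eq_one_right
    rw [hg, heisenbergMatrix_mul, ← heisenbergMatrix_zero]
    congr 1 <;> ring

instance heisenbergCentral_normal {R : Type*} [CommRing R] (L : AddSubgroup R) :
    (heisenbergCentral L).Normal where
  conj_mem := by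
    rintro g hg h
    obtain ⟨w, hw, hgw⟩ := hg
    obtain ⟨e, f, v, hh⟩ := h.2
    have hc : h * g = g * h := by
      apply Subtype.ext
      apply Units.ext
      rw [Subgroup.coe_mul, Subgroup.coe_mul, Units.val_mul, Units.val_mul, hgw, hh,
        heisenbergMatrix_mul, heisenbergMatrix_mul]
      congr 1 <;> ring
    rw [hc, mul_inv_cancel_right]
    exact ⟨w, hw, hgw⟩

/-! ### The flat groups -/

/-- The `2 × (m + 1)` matrix with rows `(e₁, …, e_m, 0)` and `(0, e₁, …, e_m)`. -/
def flatBlock {k : Type*} [Field k] {m : ℕ} (e : Fin m → k) : Matrix (Fin 2) (Fin (m + 1)) k :=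
  Matrix.of ![Fin.snoc (α := fun _ => k) e 0, Fin.cons (α := fun _ => k) 0 e]

theorem flatBlock_add {k : Type*} [Field k] {m : ℕ} (e e' : Fin m → k) :
    flatBlock (e + e') = flatBlock e + flatBlock e' := by
  ext i j
  fin_cases i
  · refine Fin.lastCases ?_ (fun j => ?_) j <;> simp [flatBlock]
  · refine Fin.cases ?_ (fun j => ?_) j <;> simp [flatBlock]

theorem flatBlock_zero {k : Type*} [Field k] {m : ℕ} : flatBlock (0 : Fin m → k) = 0 := by
  have h := flatBlock_add (0 : Fin m → k) 0
  rwa [add_zero, left_eq_add] at h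

/-- The matrix, with row and column blocks of sizes `2`, `m + 1` and `1`,
`[[I, flatBlock e, w], [0, I, f], [0, 0, 1]]`. -/
def flatMatrix {k : Type*} [Field k] {m : ℕ} (e : Fin m → k) (f : Fin (m + 1) → k)
    (w : Fin 2 → k) :
    Matrix (Fin 2 ⊕ Fin (m + 1) ⊕ Unit) (Fin 2 ⊕ Fin (m + 1) ⊕ Unit) k :=
  Matrix.fromBlocks 1 (Matrix.fromCols (flatBlock e) (Matrix.replicateCol Unit w)) 0
    (Matrix.fromBlocks 1 (Matrix.replicateCol Unit f) 0 1)

theorem flatMatrix_mul {k : Type*} [Field k] {m : ℕ} (e e' : Fin m → k)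
    (f f' : Fin (m + 1) → k) (w w' : Fin 2 → k) :
    flatMatrix e f w * flatMatrix e' f' w' =
      flatMatrix (e + e') (f + f') (w + w' + (flatBlock e).mulVec f') := by
  unfold flatMatrix
  rw [Matrix.fromBlocks_multiply, Matrix.fromBlocks_multiply,
    Matrix.fromCols_mul_fromBlocks, flatBlock_add]
  congr 1
  · simp
  · ext i j
    rcases j with j | j
    · simp [add_comm]
    · simp [Matrix.mul_apply, Matrix.mulVec, dotProduct]
      ring
  · simp
  · have h : Matrix.replicateCol Unit f' + Matrix.replicateCol Unit f =
        Matrix.replicateCol Unit (f + f') := by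
      ext i j
      simp [add_comm]
    simp [h]

theorem flatMatrix_zero {k : Type*} [Field k] {m : ℕ} :
    flatMatrix (0 : Fin m → k) 0 0 = 1 := by
  unfold flatMatrix
  rw [flatBlock_zero, ← Matrix.fromBlocks_one, ← Matrix.fromBlocks_one]
  congr 1
  · ext i j
    rcases j with j | j <;> simp

/-- The flat matrix group over `k` with parameter `m`. -/
def flatGroup (k : Type*) [Field k] (m : ℕ) : Subgroup (GL (Fin 2 ⊕ Fin (m + 1) ⊕ Unit) k) where
  carrier := {g | ∃ e f w,
    (g : Matrix (Fin 2 ⊕ Fin (m + 1) ⊕ Unit) (Fin 2 ⊕ Fin (m + 1) ⊕ Unit) k) = flatMatrix e f w}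
  mul_mem' := by
    rintro g h ⟨e, f, w, hg⟩ ⟨e', f', w', hh⟩
    exact ⟨_, _, _, by rw [Units.val_mul, hg, hh, flatMatrix_mul]⟩
  one_mem' := ⟨0, 0, 0, by rw [flatMatrix_zero]; rfl⟩
  inv_mem' := by
    rintro g ⟨e, f, w, hg⟩
    refine ⟨-e, -f, -w + (flatBlock e).mulVec f, ?_⟩
    apply Units.inv_eq_of_mul_eq_one_right
    rw [hg, flatMatrix_mul, ← flatMatrix_zero]
    congr 1
    · simp
    · simp
    · rw [Matrix.mulVec_neg]; abel

/-!
In coordinates the commutation map of `G` is a pair `(φ, ψ)` of alternating forms on `kᵈ`, and an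
orthogonal decomposition of the pair would give a central decomposition of `G`, so the pair is
indecomposable. Since isoclinism only depends on the pair, it suffices to find its normal form.

If the pencil is regular, Fitting's lemma for the linear relation `ψ⁻¹ φ` and indecomposability make
one of the forms nondegenerate, say `φ`. Then `T = φ⁻¹ ψ` is self-adjoint, its coprime primary
components are orthogonal, and so its minimal polynomial is a power `a ^ c` of an irreducible. For
suitable `v` and `w` the `k[T]`-submodule spanned by `v` and `w` is free of rank two over
`k[x]/(a ^ c)` and nondegenerate, hence everything; this is the pair of a Heisenberg quotient.

If the pencil is singular, a shortest chain `ψ v₀ = 0`, `φ vⱼ = ψ vⱼ₊₁`, `φ vₘ₊₁ = 0` is paired with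
a dual chain `w₀, …, wₘ`, because otherwise it could be shortened. The two chains span an orthogonal
summand, hence everything, and this is the pair of the flat group.
-/

section Commutation

open Subgroup Additive

theorem IsCentrallyIndecomposable.eq_top_or_eq_top {G : Type*} [Group G]
    (hG : IsCentrallyIndecomposable G) {P Q : Subgroup G} (hsup : P ⊔ Q = ⊤) (hPQ : ⁅P, Q⁆ = ⊥) :
    P = ⊤ ∨ Q = ⊤ := by
  by_contra! ⟨hP, hQ⟩
  have hne : P ≠ Q := by
    rintro rfl
    exact hP (by rwa [sup_idem] at hsup)
  have hdec : IsCentralDecomposition {P, Q} := by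
    refine ⟨by rwa [sSup_pair], ?_⟩
    rintro _ (rfl | rfl)
    · rw [Set.pair_sdiff_left hne, sSup_singleton]
      exact ⟨hQ, hPQ⟩
    · rw [Set.pair_sdiff_right hne, sSup_singleton]
      exact ⟨hP, by rwa [commutator_comm]⟩
  exact hP (Set.mem_singleton_iff.mp ((hG _).mp hdec ▸ Set.mem_insert P {Q}))

variable {G H V W V' W' : Type*} [Group G] [Group H] [AddCommGroup V] [AddCommGroup W]
  [AddCommGroup V'] [AddCommGroup W'] {B : V → V → W}

/-- The commutation map of `G` is the map `B` in suitable additive coordinates on `G/Z(G)` and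
`[G, G]`; two groups with the same such `B` are isoclinic. -/
def HasCommutation (G : Type*) [Group G] {V W : Type*} [AddCommGroup V] [AddCommGroup W]
    (B : V → V → W) : Prop :=
  ∃ (eV : Additive (G ⧸ center G) ≃+ V) (eW : Additive (commutator G) ≃+ W),
    ∀ x y : G ⧸ center G, eW (ofMul (commutation G x y)) = B (eV (ofMul x)) (eV (ofMul y))

namespace HasCommutation

theorem isoclinic (hG : HasCommutation G B) (hH : HasCommutation H B) : Isoclinic G H := by
  obtain ⟨eV, eW, hG⟩ := hG
  obtain ⟨fV, fW, hH⟩ := hH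
  refine ⟨(eV.trans fV.symm).toMultiplicative, (eW.trans fW.symm).toMultiplicative, fun x y => ?_⟩
  refine ofMul.injective (fW.injective ?_)
  refine (hH _ _).trans ?_
  refine .trans ?_ (fW.apply_symm_apply (eW (ofMul (commutation G x y)))).symm
  exact (congrArg₂ B (fV.apply_symm_apply _) (fV.apply_symm_apply _)).trans (hG x y).symm

theorem congr (hG : HasCommutation G B) {B' : V' → V' → W'} (s : V' ≃+ V) (q : W ≃+ W')
    (hq : ∀ x y, q (B (s x) (s y)) = B' x y) : HasCommutation G B' := by
  obtain ⟨eV, eW, hB⟩ := hG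
  refine ⟨eV.trans s.symm, eW.trans q, fun x y => ?_⟩
  rw [← hq, AddEquiv.trans_apply, hB]
  simp only [AddEquiv.trans_apply, AddEquiv.apply_symm_apply]

theorem exists_hom (hG : HasCommutation G B) :
    ∃ π : G →* Multiplicative V, Function.Surjective π ∧ π.ker = center G ∧
      ∀ g h, B (π g).toAdd (π h).toAdd = 0 ↔ Commute g h := by
  obtain ⟨eV, eW, hB⟩ := hG
  refine ⟨(AddEquiv.toMultiplicativeRight eV : G ⧸ center G →* _).comp (QuotientGroup.mk' _),
    (AddEquiv.toMultiplicativeRight eV).surjective.comp (QuotientGroup.mk'_surjective _), ?_,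
    fun g h => ?_⟩
  · exact (MonoidHom.ker_mulEquiv_comp _ _).trans (QuotientGroup.ker_mk' _)
  · refine (iff_of_eq (congrArg (· = 0) (hB g h).symm)).trans ?_
    rw [EmbeddingLike.map_eq_zero_iff, ofMul_eq_zero, Subtype.ext_iff, commute_iff_eq,
      ← commutatorElement_eq_one_iff_mul_comm]
    rfl

theorem self_eq_zero (hG : HasCommutation G B) (v : V) : B v v = 0 := by
  obtain ⟨π, hπ, -, hcomm⟩ := hG.exists_hom
  obtain ⟨g, hg⟩ := hπ (.ofAdd v)
  simpa only [hg, toAdd_ofAdd] using (hcomm g g).mpr (.refl g)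

theorem eq_zero_of_forall (hG : HasCommutation G B) {v : V} (hv : ∀ v', B v v' = 0) : v = 0 := by
  obtain ⟨π, hπ, hker, hcomm⟩ := hG.exists_hom
  obtain ⟨g, hg⟩ := hπ (.ofAdd v)
  have hcenter : g ∈ center G := mem_center_iff.mpr fun h =>
    ((hcomm g h).mp (by rw [hg]; exact hv _)).eq.symm
  rw [← hker, MonoidHom.mem_ker, hg, ofAdd_eq_one] at hcenter
  exact hcenter

theorem eq_top_of_forall_mem (hG : HasCommutation G B) {S : AddSubgroup W}
    (hS : ∀ x y, B x y ∈ S) : S = ⊤ := by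
  obtain ⟨eV, eW, hB⟩ := hG
  let L : Subgroup (commutator G) := (S.comap eW.toAddMonoidHom).toSubgroup'
  have hle : commutator G ≤ L.map (commutator G).subtype := by
    refine (commutator_def G).le.trans (commutator_le.mpr fun g _ h _ => ?_)
    refine ⟨commutation G g h, ?_, rfl⟩
    change eW (ofMul (commutation G g h)) ∈ S
    rw [hB]
    exact hS _ _
  rw [eq_top_iff]
  intro w _
  obtain ⟨z, hz, hzw⟩ := hle (eW.symm w).toMul.2
  rw [Subtype.ext hzw] at hz
  have hw : eW (eW.symm w) ∈ S := hz
  rwa [eW.apply_symm_apply] at hw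

theorem nontrivial [Nontrivial W] (hG : HasCommutation G B) : Nontrivial V := by
  by_contra! hV
  refine bot_ne_top (hG.eq_top_of_forall_mem (S := ⊥) fun x y => ?_)
  rw [AddSubgroup.mem_bot, Subsingleton.elim y x, hG.self_eq_zero]

theorem eq_bot_or_eq_bot_of_isCompl (hG : HasCommutation G B) (hind : IsCentrallyIndecomposable G)
    {P Q : AddSubgroup V} (hPQ : IsCompl P Q) (horth : ∀ x ∈ P, ∀ y ∈ Q, B x y = 0) :
    P = ⊥ ∨ Q = ⊥ := by
  obtain ⟨π, hπ, -, hcomm⟩ := hG.exists_hom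
  let pre : AddSubgroup V → Subgroup G := fun S => (AddSubgroup.toSubgroup S).comap π
  have hpre_top : ∀ S, pre S = ⊤ → S = ⊤ := fun S hS =>
    AddSubgroup.toSubgroup.injective (comap_injective hπ (hS.trans (comap_top π).symm))
  have hsup : pre P ⊔ pre Q = ⊤ := by
    refine (comap_sup_eq π _ _ hπ).trans ?_
    rw [← SupHomClass.map_sup, hPQ.sup_eq_top, OrderIso.map_top, comap_top]
  have hcentral : ⁅pre P, pre Q⁆ = ⊥ := by
    rw [commutator_eq_bot_iff_le_centralizer]
    exact fun g hg => mem_centralizer_iff.mpr fun h hh =>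
      ((hcomm g h).mp (horth _ hg _ hh)).eq.symm
  rcases hind.eq_top_or_eq_top hsup hcentral with hP | hQ
  · exact .inr (eq_bot_of_top_isCompl (hpre_top P hP ▸ hPQ))
  · exact .inl (eq_bot_of_isCompl_top (hpre_top Q hQ ▸ hPQ))

end HasCommutation

theorem HasGenusTwoOver.exists_hasCommutation {k : Type*} [Field k] (hk : HasGenusTwoOver k G) :
    ∃ (d : ℕ) (φ ψ : LinearMap.BilinForm k (Fin d → k)),
      HasCommutation G fun x y => ![φ x y, ψ x y] := by
  obtain ⟨d, eV, eW, B, hB⟩ := hk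
  refine ⟨d, B.compr₂ (LinearMap.proj 0), B.compr₂ (LinearMap.proj 1), eV, eW, fun x y => ?_⟩
  rw [hB]
  ext i
  fin_cases i <;> rfl

end Commutation

section Models

open Subgroup Multiplicative

variable {H V W E F : Type*} [Group H] [AddCommGroup V] [AddCommGroup W] [AddCommGroup E]
  [AddCommGroup F]

theorem hasCommutation_of_surjective_of_injective {B : V → V → W} (π : H →* Multiplicative V)
    (hπ : Function.Surjective π) (ι : Multiplicative W →* H) (hι : Function.Injective ι)
    (hB : ∀ g h, ⁅g, h⁆ = ι (ofAdd (B (π g).toAdd (π h).toAdd)))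
    (hnd : ∀ v, (∀ v', B v v' = 0) → v = 0)
    (hspan : ∀ S : AddSubgroup W, (∀ x y, B x y ∈ S) → S = ⊤) : HasCommutation H B := by
  have hcomm : ∀ g h, Commute g h ↔ B (π g).toAdd (π h).toAdd = 0 := fun g h => by
    rw [commute_iff_eq, ← commutatorElement_eq_one_iff_mul_comm, hB, map_eq_one_iff ι hι,
      ofAdd_eq_one]
  have hcenter : center H = π.ker := by
    ext g
    rw [mem_center_iff, MonoidHom.mem_ker]
    refine ⟨fun hg => toAdd_eq_zero.mp (hnd _ fun v => ?_), fun hg h => ?_⟩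
    · obtain ⟨h, hh⟩ := hπ (ofAdd v)
      rw [← toAdd_ofAdd v, ← hh, ← hcomm]
      exact (hg h).symm
    · rw [eq_comm, ← commutatorElement_eq_one_iff_mul_comm, hB, hg, ← map_one π, ← hB,
        commutatorElement_one_left]
  have hcommutator : commutator H = ι.range := by
    refine le_antisymm ((commutator_def H).le.trans (commutator_le.mpr fun g _ h _ =>
      ⟨_, (hB g h).symm⟩)) ?_
    have htop : toAddSubgroup' ((commutator H).comap ι) = ⊤ := by
      refine hspan _ fun x y => ?_
      obtain ⟨g, hg⟩ := hπ (ofAdd x)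
      obtain ⟨h, hh⟩ := hπ (ofAdd y)
      change ι (ofAdd (B (ofAdd x).toAdd (ofAdd y).toAdd)) ∈ commutator H
      rw [← hg, ← hh, ← hB]
      exact commutator_mem_commutator (mem_top g) (mem_top h)
    rintro _ ⟨w, rfl⟩
    exact htop.ge (AddSubgroup.mem_top w.toAdd)
  let eV : H ⧸ center H ≃* Multiplicative V :=
    (QuotientGroup.quotientMulEquivOfEq hcenter).trans
      (QuotientGroup.quotientKerEquivOfSurjective π hπ)
  let eW : Multiplicative W ≃* commutator H :=
    (MonoidHom.ofInjective hι).trans (MulEquiv.subgroupCongr hcommutator.symm)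
  refine ⟨MulEquiv.toAdditiveLeft eV, MulEquiv.toAdditiveLeft eW.symm, fun x y => ?_⟩
  obtain ⟨g, rfl⟩ := QuotientGroup.mk_surjective x
  obtain ⟨h, rfl⟩ := QuotientGroup.mk_surjective y
  exact congrArg toAdd (eW.symm_apply_eq.mpr (Subtype.ext (hB g h)))

/-- The commutation map attached to a biadditive map `β`: a group in which `(e, f, w)` and
`(e', f', w')` multiply to `(e + e', f + f', w + w' + β e f')` has it as commutation map. -/
def heisenbergBracket (β : E →+ F →+ W) (x y : E × F) : W := β x.1 y.2 - β y.1 x.2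

theorem hasCommutation_of_coordinates (β : E →+ F →+ W) (mk : E × F × W ≃ H)
    (hmul : ∀ e f w e' f' w',
      mk (e, f, w) * mk (e', f', w') = mk (e + e', f + f', w + w' + β e f'))
    (hleft : ∀ e, (∀ f, β e f = 0) → e = 0) (hright : ∀ f, (∀ e, β e f = 0) → f = 0)
    (hspan : ∀ S : AddSubgroup W, (∀ e f, β e f ∈ S) → S = ⊤) :
    HasCommutation H (heisenbergBracket β) := by
  let π : H →* Multiplicative (E × F) :=
    MonoidHom.mk' (fun g => ofAdd ((mk.symm g).1, (mk.symm g).2.1)) fun g h => by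
      obtain ⟨⟨e, f, w⟩, rfl⟩ := mk.surjective g
      obtain ⟨⟨e', f', w'⟩, rfl⟩ := mk.surjective h
      simp only [hmul, Equiv.symm_apply_apply]
      rfl
  let ι : Multiplicative W →* H := MonoidHom.mk' (fun w => mk (0, 0, w.toAdd)) fun w w' => by
    simp only [hmul, toAdd_mul, map_zero, add_zero]
  refine hasCommutation_of_surjective_of_injective π ?_ ι ?_ ?_ ?_ ?_
  · intro x
    exact ⟨mk (x.toAdd.1, x.toAdd.2, 0), by simp [π]⟩
  · intro w w' h
    simpa [ι] using h
  · intro g h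
    obtain ⟨⟨e, f, w⟩, rfl⟩ := mk.surjective g
    obtain ⟨⟨e', f', w'⟩, rfl⟩ := mk.surjective h
    rw [commutatorElement_def, mul_inv_eq_iff_eq_mul, mul_inv_eq_iff_eq_mul]
    simp only [ι, π, MonoidHom.mk'_apply, toAdd_ofAdd, Equiv.symm_apply_apply, hmul,
      heisenbergBracket, map_zero, AddMonoidHom.zero_apply, zero_add, add_zero]
    rw [add_comm e, add_comm f]
    congr 3
    abel
  · intro x hx
    refine Prod.ext (hleft _ fun f => ?_) (hright _ fun e => ?_)
    · simpa [heisenbergBracket] using hx (0, f)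
    · simpa [heisenbergBracket] using hx (e, 0)
  · exact fun S hS => hspan S fun e f => by simpa [heisenbergBracket] using hS (e, 0) (0, f)

section Heisenberg

variable {R : Type*} [CommRing R]

/-- The Heisenberg matrix with entries `e`, `f`, `w`, as an element of the Heisenberg group. -/
def heisenbergMk (e f w : R) : heisenberg R :=
  ⟨⟨heisenbergMatrix e f w, heisenbergMatrix (-e) (-f) (-w + e * f),
    by rw [heisenbergMatrix_mul, ← heisenbergMatrix_zero]; congr 1 <;> ring,
    by rw [heisenbergMatrix_mul, ← heisenbergMatrix_zero]; congr 1 <;> ring⟩, e, f, w, rfl⟩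

theorem heisenbergMatrix_inj {e f w e' f' w' : R} :
    heisenbergMatrix e f w = heisenbergMatrix e' f' w' ↔ e = e' ∧ f = f' ∧ w = w' := by
  refine ⟨fun h => ⟨?_, ?_, ?_⟩, by rintro ⟨rfl, rfl, rfl⟩; rfl⟩
  · exact congrFun (congrFun h 0) 1
  · exact congrFun (congrFun h 1) 2
  · exact congrFun (congrFun h 0) 2

theorem exists_eq_heisenbergMk (g : heisenberg R) : ∃ e f w, g = heisenbergMk e f w := by
  obtain ⟨e, f, w, h⟩ := g.2
  exact ⟨e, f, w, Subtype.ext (Units.ext h)⟩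

theorem heisenbergMk_mul (e f w e' f' w' : R) :
    heisenbergMk e f w * heisenbergMk e' f' w' =
      heisenbergMk (e + e') (f + f') (w + w' + e * f') :=
  Subtype.ext (Units.ext (heisenbergMatrix_mul e f w e' f' w'))

theorem heisenbergMk_inv (e f w : R) :
    (heisenbergMk e f w)⁻¹ = heisenbergMk (-e) (-f) (-w + e * f) :=
  Subtype.ext (Units.ext rfl)

theorem heisenbergMk_mem_heisenbergCentral {L : AddSubgroup R} {e f w : R} :
    heisenbergMk e f w ∈ heisenbergCentral L ↔ e = 0 ∧ f = 0 ∧ w ∈ L := by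
  constructor
  · rintro ⟨w', hw', h⟩
    obtain ⟨rfl, rfl, rfl⟩ := heisenbergMatrix_inj.mp h
    exact ⟨rfl, rfl, hw'⟩
  · rintro ⟨rfl, rfl, hw⟩
    exact ⟨w, hw, rfl⟩

theorem heisenbergCentral_le_commutator (L : AddSubgroup R) :
    heisenbergCentral L ≤ commutator (heisenberg R) := by
  intro g hg
  obtain ⟨e, f, w, rfl⟩ := exists_eq_heisenbergMk g
  obtain ⟨rfl, rfl, -⟩ := heisenbergMk_mem_heisenbergCentral.mp hg
  have hcomm : ⁅heisenbergMk (1 : R) 0 0, heisenbergMk 0 w 0⁆ = heisenbergMk 0 0 w := by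
    simp only [commutatorElement_def, heisenbergMk_inv, heisenbergMk_mul]
    congr 1 <;> ring
  rw [← hcomm, commutator_def]
  exact commutator_mem_commutator (mem_top _) (mem_top _)

theorem mk_heisenbergMk_eq_iff {L : AddSubgroup R} {e f w e' f' w' : R} :
    (heisenbergMk e f w : heisenberg R ⧸ heisenbergCentral L) = heisenbergMk e' f' w' ↔
      e = e' ∧ f = f' ∧ w' - w ∈ L := by
  rw [QuotientGroup.eq, heisenbergMk_inv, heisenbergMk_mul, heisenbergMk_mem_heisenbergCentral,
    neg_add_eq_zero, neg_add_eq_zero]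
  refine and_congr_right fun _ => and_congr_right fun hf => ?_
  rw [hf, show -w + e * f' + w' + -e * f' = w' - w by ring]

theorem hasCommutation_heisenberg_quotient {W : Type*} [AddCommGroup W] (q : R →+ W)
    (hq : Function.Surjective q) (hnd : ∀ r, (∀ t, q (t * r) = 0) → r = 0) :
    HasCommutation (heisenberg R ⧸ heisenbergCentral q.ker)
      (heisenbergBracket (AddMonoidHom.mul.compr₂ q)) := by
  let mk : R × R × W → heisenberg R ⧸ heisenbergCentral q.ker := fun x =>
    heisenbergMk x.1 x.2.1 (Function.surjInv hq x.2.2)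
  have hmk_eq : ∀ e f w w', q w' = w → mk (e, f, w) = heisenbergMk e f w' := fun e f w w' hw' =>
    mk_heisenbergMk_eq_iff.mpr ⟨rfl, rfl, by
      rw [AddMonoidHom.mem_ker, map_sub, hw', Function.surjInv_eq hq, sub_self]⟩
  have hmk : Function.Bijective mk := by
    refine ⟨?_, fun x => ?_⟩
    · rintro ⟨e, f, w⟩ ⟨e', f', w'⟩ h
      obtain ⟨rfl, rfl, hw⟩ := mk_heisenbergMk_eq_iff.mp h
      rw [AddMonoidHom.mem_ker, map_sub, Function.surjInv_eq hq, Function.surjInv_eq hq,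
        sub_eq_zero] at hw
      exact congrArg (fun u => (e, f, u)) hw.symm
    · obtain ⟨g, rfl⟩ := QuotientGroup.mk_surjective x
      obtain ⟨e, f, w, rfl⟩ := exists_eq_heisenbergMk g
      exact ⟨(e, f, q w), hmk_eq e f _ w rfl⟩
  refine hasCommutation_of_coordinates _ (.ofBijective mk hmk) ?_ ?_ ?_ ?_
  · intro e f w e' f' w'
    symm
    refine (hmk_eq _ _ _ _ ?_).trans (congrArg _ (heisenbergMk_mul e f _ e' f' _).symm)
    simp [Function.surjInv_eq hq]
  · intro e he
    exact hnd e fun t => by rw [mul_comm]; exact he t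
  · exact hnd
  · intro S hS
    rw [eq_top_iff]
    intro w _
    obtain ⟨r, rfl⟩ := hq w
    simpa using hS 1 r

end Heisenberg

section Flat

variable {k : Type*} [Field k] {m : ℕ}

/-- The flat matrix with blocks `e`, `f`, `w`, as an element of the flat group. -/
def flatMk (e : Fin m → k) (f : Fin (m + 1) → k) (w : Fin 2 → k) : flatGroup k m :=
  ⟨⟨flatMatrix e f w, flatMatrix (-e) (-f) (-w + (flatBlock e).mulVec f),
    by
      rw [flatMatrix_mul, ← flatMatrix_zero, Matrix.mulVec_neg]
      congr 1 <;> abel,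
    by
      have h : flatBlock (-e) = -flatBlock e := by
        rw [eq_neg_iff_add_eq_zero, ← flatBlock_add, neg_add_cancel, flatBlock_zero]
      rw [flatMatrix_mul, ← flatMatrix_zero, h, Matrix.neg_mulVec]
      congr 1 <;> abel⟩, e, f, w, rfl⟩

theorem flatMatrix_inj {e e' : Fin m → k} {f f' : Fin (m + 1) → k} {w w' : Fin 2 → k} :
    flatMatrix e f w = flatMatrix e' f' w' ↔ e = e' ∧ f = f' ∧ w = w' := by
  refine ⟨fun h => ⟨funext fun i => ?_, funext fun i => ?_, funext fun i => ?_⟩,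
    by rintro ⟨rfl, rfl, rfl⟩; rfl⟩
  · simpa [flatMatrix, flatBlock] using
      congrFun (congrFun h (Sum.inl 0)) (Sum.inr (Sum.inl i.castSucc))
  · exact congrFun (congrFun h (Sum.inr (Sum.inl i))) (Sum.inr (Sum.inr ()))
  · exact congrFun (congrFun h (Sum.inl i)) (Sum.inr (Sum.inr ()))

theorem flatMk_bijective :
    Function.Bijective fun x : (Fin m → k) × (Fin (m + 1) → k) × (Fin 2 → k) =>
      flatMk x.1 x.2.1 x.2.2 := by
  refine ⟨fun ⟨e, f, w⟩ ⟨e', f', w'⟩ h => ?_, fun ⟨g, e, f, w, hg⟩ => ?_⟩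
  · obtain ⟨rfl, rfl, rfl⟩ := flatMatrix_inj.mp (congrArg (fun g : flatGroup k m => g.1.1) h)
    rfl
  · exact ⟨(e, f, w), Subtype.ext (Units.ext hg.symm)⟩

/-- The biadditive map `(e, f) ↦ flatBlock e * f` that governs multiplication in the flat group. -/
def flatPairing (k : Type*) [Field k] (m : ℕ) :
    (Fin m → k) →+ (Fin (m + 1) → k) →+ (Fin 2 → k) :=
  AddMonoidHom.mk' (fun e => (flatBlock e).mulVecLin.toAddMonoidHom) fun e e' =>
    AddMonoidHom.ext fun f => by simp [flatBlock_add]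

theorem flatPairing_apply (e : Fin m → k) (f : Fin (m + 1) → k) :
    flatPairing k m e f = ![∑ i, e i * f i.castSucc, ∑ i, e i * f i.succ] := by
  ext i
  fin_cases i
  · simp [flatPairing, flatBlock, dotProduct, Fin.sum_univ_castSucc]
  · simp [flatPairing, flatBlock, dotProduct, Fin.sum_univ_succ]

theorem hasCommutation_flatGroup (k : Type*) [Field k] (m : ℕ) :
    HasCommutation (flatGroup k (m + 1)) (heisenbergBracket (flatPairing k (m + 1))) := by
  refine hasCommutation_of_coordinates _ (.ofBijective _ flatMk_bijective) ?_ ?_ ?_ ?_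
  · exact fun e f w e' f' w' => Subtype.ext (Units.ext (flatMatrix_mul e e' f f' w w'))
  · intro e he
    funext i
    simpa [flatPairing_apply, Pi.single_apply] using congrFun (he (Pi.single i.castSucc 1)) 0
  · intro f hf
    have hcast : ∀ i : Fin (m + 1), f i.castSucc = 0 := fun i => by
      simpa [flatPairing_apply, Pi.single_apply] using congrFun (hf (Pi.single i 1)) 0
    have hsucc : ∀ i : Fin (m + 1), f i.succ = 0 := fun i => by
      simpa [flatPairing_apply, Pi.single_apply] using congrFun (hf (Pi.single i 1)) 1
    funext i
    exact i.cases (hcast 0) hsucc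
  · intro S hS
    rw [eq_top_iff]
    intro w _
    have hw : flatPairing k (m + 1) (Pi.single 0 1) (Fin.cons (w 0) (Fin.cons (w 1) 0)) = w := by
      ext i
      fin_cases i <;> simp [flatPairing_apply, Pi.single_apply]
    exact hw ▸ hS _ _

end Flat

end Models

section Pencil

open Module LinearMap.BilinForm

variable {k V : Type*} [Field k] [AddCommGroup V] [Module k V] {φ ψ : LinearMap.BilinForm k V}

/-- The pair of forms `(φ, ψ)` is not a direct sum of two nonzero pairs: no decomposition of the
space into two nonzero summands is orthogonal for both forms. -/
def OrthogonallyIndecomposable (φ ψ : LinearMap.BilinForm k V) : Prop :=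
  ∀ P Q : Submodule k V, IsCompl P Q → (∀ x ∈ P, ∀ y ∈ Q, φ x y = 0 ∧ ψ x y = 0) →
    P = ⊥ ∨ Q = ⊥

theorem OrthogonallyIndecomposable.bijective [FiniteDimensional k V] {U U' : Type*}
    [AddCommGroup U] [Module k U] [Nontrivial U] [AddCommGroup U'] [Module k U']
    [FiniteDimensional k U'] (hind : OrthogonallyIndecomposable φ ψ) (s : U →ₗ[k] V)
    (hs : ∀ x, (∀ y, φ (s y) (s x) = 0 ∧ ψ (s y) (s x) = 0) → x = 0) (c : V →ₗ[k] U')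
    (hdim : finrank k U' ≤ finrank k U)
    (hc : ∀ y, c y = 0 → ∀ x, φ (s x) y = 0 ∧ ψ (s x) y = 0) : Function.Bijective s := by
  have hinj : Function.Injective s := (injective_iff_map_eq_zero s).mpr fun x hx =>
    hs x fun y => by rw [hx, map_zero, map_zero]; exact ⟨rfl, rfl⟩
  have hcompl : IsCompl (LinearMap.range s) (LinearMap.ker c) := by
    refine (Submodule.isCompl_iff_disjoint _ _ ?_).mpr (Submodule.disjoint_def.mpr ?_)
    · rw [LinearMap.finrank_range_of_inj hinj, ← c.finrank_range_add_finrank_ker]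
      exact Nat.add_le_add_right ((Submodule.finrank_le _).trans hdim) _
    · rintro _ ⟨x, rfl⟩ hx
      rw [hs x (hc _ hx), map_zero]
  refine ⟨hinj, LinearMap.range_eq_top.mp ?_⟩
  rcases hind _ _ hcompl (by rintro _ ⟨x, rfl⟩ y hy; exact hc y hy x) with hbot | hbot
  · obtain ⟨x, hx⟩ := exists_ne (0 : U)
    exact absurd (hinj.eq_iff' (map_zero s) |>.mp
      (LinearMap.congr_fun (LinearMap.range_eq_bot.mp hbot) x)) hx
  · exact eq_top_of_isCompl_bot (hbot ▸ hcompl)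

theorem apply_add_add_of_isotropic (hφ : φ.IsAlt) {e e' f f' : V} (he : φ e e' = 0)
    (hf : φ f f' = 0) : φ (e + f) (e' + f') = φ e f' - φ e' f := by
  rw [add_left, add_right, add_right, he, hf, zero_add, add_zero, ← hφ.neg_eq e' f,
    ← sub_eq_add_neg]

theorem isotropic_of_sequence (hφ : φ.IsAlt) (hψ : ψ.IsAlt) {u : ℕ → V} {n : ℕ}
    (hu : ∀ j < n, φ (u j) = ψ (u (j + 1))) {i j : ℕ} (hi : i ≤ n) (hj : j ≤ n) :
    φ (u i) (u j) = 0 ∧ ψ (u i) (u j) = 0 := by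
  have hψ_add : ∀ d i, i + d ≤ n → ψ (u i) (u (i + d)) = 0 := by
    intro d
    induction d using Nat.twoStepInduction with
    | zero => exact fun i _ => hψ (u i)
    | one =>
      intro i hi
      rw [← hψ.neg_eq, ← hu i (by lia), hφ (u i), neg_zero]
    | more d ih _ =>
      intro i hi
      have hshift : ψ (u i) (u (i + (d + 2))) = ψ (u (i + 1)) (u (i + 1 + d)) := by
        rw [← hψ.neg_eq, show i + (d + 2) = i + 1 + d + 1 by ring, ← hu _ (by lia), hφ.neg_eq,
          hu i (by lia)]
      rw [hshift, ih _ (by lia)]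
  have hψ_all : ∀ {i j}, i ≤ n → j ≤ n → ψ (u i) (u j) = 0 := by
    intro i j hi hj
    rcases le_total i j with hij | hij
    · obtain ⟨d, rfl⟩ := Nat.exists_eq_add_of_le hij
      exact hψ_add d i hj
    · obtain ⟨d, rfl⟩ := Nat.exists_eq_add_of_le hij
      rw [← hψ.neg_eq, hψ_add d j hi, neg_zero]
  refine ⟨?_, hψ_all hi hj⟩
  rcases hi.lt_or_eq with hi' | rfl
  · rw [hu i hi', hψ_all hi' hj]
  rcases hj.lt_or_eq with hj' | rfl
  · rw [← hφ.neg_eq, hu j hj', hψ_all hj' hi, neg_zero]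
  · exact hφ _

/-- The vectors `v` with `φ v = ψ u` for some `u ∈ S`: the preimage of `S` under the linear
relation `ψ⁻¹ φ`. -/
def pencilStep (φ ψ : LinearMap.BilinForm k V) (S : Submodule k V) : Submodule k V :=
  (S.map ψ).comap φ

theorem pencilStep_mono (φ ψ : LinearMap.BilinForm k V) : Monotone (pencilStep φ ψ) :=
  fun _ _ h => Submodule.comap_mono (Submodule.map_mono h)

theorem monotone_iterate_pencilStep_bot (φ ψ : LinearMap.BilinForm k V) :
    Monotone fun n => (pencilStep φ ψ)^[n] ⊥ :=
  (pencilStep_mono φ ψ).monotone_iterate_of_le_map bot_le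

theorem exists_sequence_of_mem_iterate_pencilStep {S : Submodule k V} {n : ℕ} {v : V}
    (hv : v ∈ (pencilStep φ ψ)^[n] S) :
    ∃ u : ℕ → V, u 0 = v ∧ (∀ j < n, φ (u j) = ψ (u (j + 1))) ∧ u n ∈ S := by
  induction n generalizing v with
  | zero => exact ⟨fun _ => v, rfl, by simp, hv⟩
  | succ n ih =>
    rw [Function.iterate_succ_apply'] at hv
    obtain ⟨v', hv', heq⟩ := hv
    obtain ⟨u, rfl, hu, hmem⟩ := ih hv'
    refine ⟨fun | 0 => v | j + 1 => u j, rfl, fun j hj => ?_, hmem⟩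
    cases j with
    | zero => exact heq.symm
    | succ j => exact hu j (by lia)

theorem orthogonal_orthogonal_eq_pencilStep [FiniteDimensional k V] (hφ : φ.IsRefl)
    (S : Submodule k V) : φ.orthogonal (ψ.orthogonal S) = pencilStep φ ψ S := by
  have hψS : ψ.orthogonal S = (S.map ψ).dualCoannihilator := by
    ext x
    simp [mem_orthogonal_iff, Submodule.mem_dualCoannihilator]
  ext x
  rw [pencilStep, Submodule.mem_comap, ← Subspace.dualCoannihilator_dualAnnihilator_eq
    (W := S.map ψ), ← hψS, Submodule.mem_dualAnnihilator, mem_orthogonal_iff]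
  exact forall₂_congr fun y _ => hφ.eq_iff

theorem orthogonal_iterate_pencilStep_bot [FiniteDimensional k V] (hφ : φ.IsRefl) (hψ : ψ.IsRefl)
    (n : ℕ) : ψ.orthogonal ((pencilStep φ ψ)^[n] ⊥) = (pencilStep ψ φ)^[n] ⊤ := by
  have hsemi : Function.Semiconj ψ.orthogonal (pencilStep φ ψ) (pencilStep ψ φ) := fun S => by
    rw [← orthogonal_orthogonal_eq_pencilStep hφ, orthogonal_orthogonal_eq_pencilStep hψ]
  rw [hsemi.iterate_right n ⊥, orthogonal_bot]

/-- The pair `(φ, ψ)` is regular: no nonzero sequence `u₀, …, u_{n-1}` satisfies `ψ u₀ = 0`,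
`φ uⱼ = ψ uⱼ₊₁` and `φ u_{n-1} = 0`. Over an infinite field this says that some form of the pencil
spanned by `φ` and `ψ` is nondegenerate. -/
def PencilRegular (φ ψ : LinearMap.BilinForm k V) : Prop :=
  ∀ n, Disjoint ((pencilStep φ ψ)^[n] ⊥) (LinearMap.ker ψ)

-- The Fitting decomposition of the linear relation `ψ⁻¹ φ`, with the generalized kernel as `K`.
theorem PencilRegular.exists_isCompl [FiniteDimensional k V] (hreg : PencilRegular φ ψ)
    (hφ : φ.IsAlt) (hψ : ψ.IsAlt) :
    ∃ K : Submodule k V, IsCompl K (ψ.orthogonal K) ∧ φ.orthogonal (ψ.orthogonal K) = K ∧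
      Disjoint K (LinearMap.ker ψ) ∧ LinearMap.ker φ ≤ K := by
  obtain ⟨n, hn⟩ := monotone_stabilizes_iff_noetherian.mpr (inferInstanceAs (IsNoetherian k V))
    ⟨_, monotone_iterate_pencilStep_bot φ ψ⟩
  set K := (pencilStep φ ψ)^[n] ⊥ with hK
  set M := ψ.orthogonal K with hM
  have hMK : φ.orthogonal M = K := by
    rw [hM, orthogonal_orthogonal_eq_pencilStep hφ.isRefl, hK]
    exact (Function.iterate_succ_apply' _ n ⊥).symm.trans (hn (n + 1) n.le_succ).symm
  have hdim : finrank k K + finrank k M = finrank k V := by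
    rw [ψ.finrank_add_finrank_orthogonal', (hreg n).eq_bot, finrank_bot, add_zero]
  have hMφ : Disjoint M (LinearMap.ker φ) := by
    have hdim' := φ.finrank_add_finrank_orthogonal' M
    rw [hMK] at hdim'
    refine disjoint_iff.mpr (Submodule.finrank_eq_zero.mp ?_)
    apply Nat.add_left_cancel (n := finrank k V)
    rw [← hdim', add_comm, hdim, add_zero]
  have hdisj : ∀ i, Disjoint ((pencilStep φ ψ)^[i] ⊥) M := by
    intro i
    induction i with
    | zero => exact disjoint_bot_left
    | succ i ih =>
      rw [Function.iterate_succ_apply', Submodule.disjoint_def]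
      rintro v ⟨u, hu, huv⟩ hvM
      have huM : u ∈ M := fun y hy => hψ.isRefl _ _ <| by
        rw [huv]
        exact (hMK.ge hy) v hvM
      rw [Submodule.disjoint_def.mp ih u hu huM, map_zero] at huv
      exact Submodule.disjoint_def.mp hMφ v hvM huv.symm
  refine ⟨K, (Submodule.isCompl_iff_disjoint _ _ hdim.ge).mpr (hdisj n), hMK, hreg n, ?_⟩
  rw [← hMK]
  exact fun x hx y _ => hφ.isRefl _ _ (by rw [LinearMap.mem_ker.mp hx, LinearMap.zero_apply])

theorem PencilRegular.nondegenerate_or_nondegenerate [FiniteDimensional k V]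
    (hreg : PencilRegular φ ψ) (hφ : φ.IsAlt) (hψ : ψ.IsAlt)
    (hind : OrthogonallyIndecomposable φ ψ) : φ.Nondegenerate ∨ ψ.Nondegenerate := by
  obtain ⟨K, hcompl, hKK, hKψ, hφK⟩ := hreg.exists_isCompl hφ hψ
  have horth : ∀ x ∈ K, ∀ y ∈ ψ.orthogonal K, φ x y = 0 ∧ ψ x y = 0 := fun x hx y hy =>
    ⟨hφ.isRefl _ _ (hKK.ge hx y hy), hy x hx⟩
  refine (hind _ _ hcompl horth).imp (fun hK => ?_) fun hM => ?_
  · exact nondegenerate_iff_ker_eq_bot.mpr (le_bot_iff.mp (hφK.trans hK.le))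
  · have hK : K = ⊤ := eq_top_of_isCompl_bot (hM ▸ hcompl)
    exact nondegenerate_iff_ker_eq_bot.mpr (top_disjoint.mp (hK ▸ hKψ))

/-- The vectors `v₀, …, v_{m+1}` and `w₀, …, w_m` are dual sequences for the singular Kronecker
block of index `m + 1`: the `v`s form a sequence as excluded in `PencilRegular`, and the `w`s, by
stepping in the opposite direction, are paired with them. The later terms of `v` and `w` are
arbitrary. -/
structure IsKroneckerPair (φ ψ : LinearMap.BilinForm k V) (m : ℕ) (v w : ℕ → V) : Prop where
  right_zero : ψ (v 0) = 0
  step : ∀ j ≤ m, φ (v j) = ψ (v (j + 1))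
  left_last : φ (v (m + 1)) = 0
  dual_step : ∀ j < m, ψ (w j) = φ (w (j + 1))
  pairing : φ (w 0) (v 0) = 1

theorem exists_isKroneckerPair [FiniteDimensional k V] (hφ : φ.IsAlt) (hψ : ψ.IsAlt)
    (hnd : Disjoint (LinearMap.ker φ) (LinearMap.ker ψ)) (hreg : ¬ PencilRegular φ ψ) :
    ∃ m v w, IsKroneckerPair φ ψ m v w := by
  classical
  have hex := not_forall.mp hreg
  obtain ⟨m, hm⟩ : ∃ m, Nat.find hex = m + 2 := by
    refine Nat.exists_eq_add_of_le' ((Nat.two_le_iff _).mpr ⟨fun h => ?_, fun h => ?_⟩)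
    · exact (h ▸ Nat.find_spec hex) disjoint_bot_left
    · refine (h ▸ Nat.find_spec hex) ?_
      rwa [Function.iterate_one, pencilStep, Submodule.map_bot]
  have hmin : Disjoint ((pencilStep φ ψ)^[m + 1] ⊥) (LinearMap.ker ψ) :=
    not_not.mp (Nat.find_min hex (by lia))
  have hnot := Nat.find_spec hex
  rw [hm, Submodule.disjoint_def] at hnot
  push Not at hnot
  obtain ⟨v₀, hv₀, hψv₀, hne⟩ := hnot
  obtain ⟨v, rfl, hv, hlast⟩ := exists_sequence_of_mem_iterate_pencilStep hv₀
  obtain ⟨w₀, hw₀, hpair⟩ : ∃ w₀ ∈ (pencilStep ψ φ)^[m] ⊤, φ w₀ (v 0) ≠ 0 := by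
    by_contra! hall
    refine hne (Submodule.disjoint_def.mp hmin _ ?_ hψv₀)
    rwa [Function.iterate_succ_apply', ← orthogonal_orthogonal_eq_pencilStep hφ.isRefl,
      orthogonal_iterate_pencilStep_bot hφ.isRefl hψ.isRefl]
  obtain ⟨w, rfl, hw, -⟩ := exists_sequence_of_mem_iterate_pencilStep hw₀
  refine ⟨m, v, fun j => (φ (w 0) (v 0))⁻¹ • w j, hψv₀, fun j hj => hv j (by lia), ?_,
    fun j hj => ?_, ?_⟩
  · rw [hv (m + 1) (by lia), (Submodule.mem_bot k).mp hlast, map_zero]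
  · rw [map_smul, map_smul, hw j hj]
  · rw [map_smul, LinearMap.smul_apply, smul_eq_mul, inv_mul_cancel₀ hpair]

/-- The linear combinations of the vectors `w₀, …, w_m` and `v₀, …, v_{m+1}`, as a linear map. -/
def kroneckerMap (k : Type*) {V : Type*} [Field k] [AddCommGroup V] [Module k V] (m : ℕ)
    (v w : ℕ → V) : ((Fin (m + 1) → k) × (Fin (m + 2) → k)) →ₗ[k] V :=
  (Fintype.linearCombination k fun i : Fin (m + 1) => w i).coprod
    (Fintype.linearCombination k fun j : Fin (m + 2) => v j)

theorem kroneckerMap_apply (m : ℕ) (v w : ℕ → V) (x : (Fin (m + 1) → k) × (Fin (m + 2) → k)) :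
    kroneckerMap k m v w x = ∑ i, x.1 i • w i + ∑ j, x.2 j • v j := rfl

theorem apply_sum_smul_sum_smul {ι ι' : Type*} [Fintype ι] [Fintype ι'] [DecidableEq ι']
    {w : ι → V} {v : ι' → V} {σ : ι → ι'} (h : ∀ i j, φ (w i) (v j) = if j = σ i then 1 else 0)
    (a : ι → k) (b : ι' → k) :
    φ (∑ i, a i • w i) (∑ j, b j • v j) = ∑ i, a i * b (σ i) := by
  rw [LinearMap.BilinForm.sum_left]
  simp [h, mul_comm]

namespace IsKroneckerPair

variable {m : ℕ} {v w : ℕ → V}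

theorem left_apply (h : IsKroneckerPair φ ψ m v w) (hφ : φ.IsAlt) (hψ : ψ.IsAlt) {i j : ℕ}
    (hi : i ≤ m) (hj : j ≤ m + 1) : φ (w i) (v j) = if j = i then 1 else 0 := by
  have hshift : ∀ {i j} t, i + t ≤ m → j + t ≤ m + 1 →
      φ (w (i + t)) (v (j + t)) = φ (w i) (v j) := by
    intro i j t hi hj
    induction t with
    | zero => rfl
    | succ t ih =>
      rw [← ih (by lia) (by lia), ← add_assoc, ← add_assoc, ← h.dual_step _ (by lia),
        ← hψ.neg_eq, ← h.step _ (by lia), hφ.neg_eq]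
  rcases lt_trichotomy j i with hji | rfl | hij
  · obtain ⟨d, rfl⟩ := Nat.exists_eq_add_of_lt hji
    have hzero := hshift (i := d + 1) (j := 0) j (by lia) (by lia)
    rw [zero_add] at hzero
    rw [if_neg hji.ne, show j + d + 1 = d + 1 + j by ring, hzero, ← h.dual_step d (by lia),
      ← hψ.neg_eq, h.right_zero, LinearMap.zero_apply, neg_zero]
  · have hone := hshift (i := 0) (j := 0) j (by lia) (by lia)
    rw [zero_add, h.pairing] at hone
    rw [hone, if_pos rfl]
  · rw [if_neg hij.ne', ← hshift (m + 1 - j) (by lia) (by lia), Nat.add_sub_of_le hj, ← hφ.neg_eq,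
      h.left_last, LinearMap.zero_apply, neg_zero]

theorem right_apply (h : IsKroneckerPair φ ψ m v w) (hφ : φ.IsAlt) (hψ : ψ.IsAlt) {i j : ℕ}
    (hi : i ≤ m) (hj : j ≤ m + 1) : ψ (w i) (v j) = if j = i + 1 then 1 else 0 := by
  cases j with
  | zero => rw [← hψ.neg_eq, h.right_zero, LinearMap.zero_apply, neg_zero, if_neg (by lia)]
  | succ j =>
    rw [← hψ.neg_eq, ← h.step j (by lia), hφ.neg_eq, h.left_apply hφ hψ hi (by lia)]
    simp only [add_left_inj]

theorem apply_kroneckerMap (h : IsKroneckerPair φ ψ m v w) (hφ : φ.IsAlt) (hψ : ψ.IsAlt)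
    (x y : (Fin (m + 1) → k) × (Fin (m + 2) → k)) :
    ![φ (kroneckerMap k m v w x) (kroneckerMap k m v w y),
      ψ (kroneckerMap k m v w x) (kroneckerMap k m v w y)] =
      heisenbergBracket (flatPairing k (m + 1)) x y := by
  have hvv := fun i j : Fin (m + 2) =>
    isotropic_of_sequence hφ hψ (fun j hj => h.step j (by lia)) i.is_le j.is_le
  have hww := fun i j : Fin (m + 1) =>
    isotropic_of_sequence hψ hφ h.dual_step i.is_le j.is_le
  have hφwv : ∀ (i : Fin (m + 1)) (j : Fin (m + 2)),
      φ (w i) (v j) = if j = i.castSucc then 1 else 0 := fun i j => by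
    simp only [h.left_apply hφ hψ i.is_le j.is_le, Fin.ext_iff, Fin.val_castSucc]
  have hψwv : ∀ (i : Fin (m + 1)) (j : Fin (m + 2)),
      ψ (w i) (v j) = if j = i.succ then 1 else 0 := fun i j => by
    simp only [h.right_apply hφ hψ i.is_le j.is_le, Fin.ext_iff, Fin.val_succ]
  rw [kroneckerMap_apply, kroneckerMap_apply, apply_add_add_of_isotropic hφ,
    apply_add_add_of_isotropic hψ, apply_sum_smul_sum_smul hφwv, apply_sum_smul_sum_smul hφwv,
    apply_sum_smul_sum_smul hψwv, apply_sum_smul_sum_smul hψwv, heisenbergBracket,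
    flatPairing_apply, flatPairing_apply]
  · simp
  all_goals simp [map_sum, LinearMap.sum_apply, hvv, hww]

theorem kroneckerMap_bijective [FiniteDimensional k V] (h : IsKroneckerPair φ ψ m v w)
    (hφ : φ.IsAlt) (hψ : ψ.IsAlt) (hind : OrthogonallyIndecomposable φ ψ) :
    Function.Bijective (kroneckerMap k m v w) := by
  let c : V →ₗ[k] (Fin (m + 1) → k) × (Fin (m + 1) → k) × k :=
    (LinearMap.pi fun j : Fin (m + 1) => φ (v j)).prod
      ((LinearMap.pi fun i : Fin (m + 1) => φ (w i)).prod (ψ (w m)))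
  refine hind.bijective _ (fun x hx => ?_) c ?_ fun y hy => ?_
  · -- The flat bracket is nondegenerate, being the commutation map of a group.
    refine (hasCommutation_flatGroup k m).eq_zero_of_forall fun y => ?_
    rw [heisenbergBracket, ← neg_sub, ← heisenbergBracket, ← h.apply_kroneckerMap hφ hψ,
      (hx y).1, (hx y).2]
    simp
  · simp only [finrank_prod, finrank_fin_fun, finrank_self]
    lia
  · have hφv : ∀ j : Fin (m + 2), φ (v j) y = 0 := fun j => j.lastCases
      (by rw [Fin.val_last, h.left_last, LinearMap.zero_apply]) (congrFun (congrArg (·.1) hy))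
    have hψv : ∀ j : Fin (m + 2), ψ (v j) y = 0 := fun j => j.cases
      (by rw [Fin.val_zero, h.right_zero, LinearMap.zero_apply]) fun j => by
        rw [Fin.val_succ, ← h.step _ j.is_le]
        exact hφv j.castSucc
    have hφw : ∀ i : Fin (m + 1), φ (w i) y = 0 := congrFun (congrArg (·.2.1) hy)
    have hψw : ∀ i : Fin (m + 1), ψ (w i) y = 0 := fun i => i.lastCases
      (congrArg (·.2.2) hy) fun i => by
        rw [Fin.val_castSucc, h.dual_step _ i.is_lt]
        exact hφw i.succ
    simp [kroneckerMap_apply, hφv, hψv, hφw, hψw]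

end IsKroneckerPair

section Sloped

theorem exists_mul_eq_mk_pow {a : k[X]} (ha : Irreducible a) {c : ℕ}
    {r : AdjoinRoot (a ^ (c + 1))} (hr : r ≠ 0) :
    ∃ t, t * r = AdjoinRoot.mk (a ^ (c + 1)) (a ^ c) := by
  classical
  obtain ⟨p, rfl⟩ := AdjoinRoot.mk_surjective r
  have hp : ¬ a ^ (c + 1) ∣ p := fun h => hr (AdjoinRoot.mk_eq_zero.mpr h)
  obtain ⟨i, hi, hassoc⟩ := (dvd_prime_pow ha.prime _).mp
    (EuclideanDomain.gcd_dvd_right p (a ^ (c + 1)))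
  have hic : i ≤ c := Nat.lt_succ_iff.mp <| hi.lt_of_ne fun h =>
    hp ((h ▸ hassoc.dvd').trans (EuclideanDomain.gcd_dvd_left p _))
  have hbezout : a ^ c ∈ Ideal.span {p, a ^ (c + 1)} := by
    rw [← EuclideanDomain.span_gcd, Ideal.mem_span_singleton]
    exact hassoc.dvd.trans (pow_dvd_pow a hic)
  obtain ⟨y, z, hyz⟩ := Ideal.mem_span_pair.mp hbezout
  refine ⟨AdjoinRoot.mk _ y, ?_⟩
  rw [← map_mul, ← sub_eq_zero, ← map_sub, AdjoinRoot.mk_eq_zero]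
  exact ⟨-z, by linear_combination hyz⟩

theorem exists_aeval_irreducible_pow_eq_zero {A : Type*} [Ring A] [Algebra k A] [Nontrivial A]
    {x : A} (hx : IsIntegral k x)
    (h : ∀ f g : k[X], IsCoprime f g → aeval x (f * g) = 0 → aeval x f = 0 ∨ aeval x g = 0) :
    ∃ (a : k[X]) (c : ℕ), Irreducible a ∧ aeval x (a ^ (c + 1)) = 0 ∧ aeval x (a ^ c) ≠ 0 := by
  have hne := minpoly.ne_zero hx
  obtain ⟨a, ha, hdvd⟩ := WfDvdMonoid.exists_irreducible_factor (minpoly.not_isUnit k x) hne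
  obtain ⟨b, hb, hab⟩ :=
    (FiniteMultiplicity.of_not_isUnit ha.not_isUnit hne).exists_eq_pow_mul_and_not_dvd
  have hpow : aeval x (a ^ multiplicity a (minpoly k x)) = 0 := by
    refine (h _ b (ha.coprime_iff_not_dvd.mpr hab).pow_left ?_).resolve_right fun hbx => hab ?_
    · rw [← hb, minpoly.aeval]
    · exact hdvd.trans (minpoly.dvd k x hbx)
  have hex : ∃ n, aeval x (a ^ n) = 0 := ⟨_, hpow⟩
  classical
  obtain ⟨c, hc⟩ : ∃ c, Nat.find hex = c + 1 := Nat.exists_eq_succ_of_ne_zero fun h0 => by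
    exact one_ne_zero (α := A) (by simpa only [h0, pow_zero, map_one] using Nat.find_spec hex)
  exact ⟨a, c, ha, hc ▸ Nat.find_spec hex, Nat.find_min hex (by lia)⟩

variable {T : End k V}

theorem isSelfAdjoint_aeval (hφ : φ.IsAlt) (hψ : ψ.IsAlt) (hT : ∀ x, φ (T x) = ψ x) (p : k[X]) :
    φ.IsSelfAdjoint (aeval T p) := by
  have hself : φ.IsSelfAdjoint T := fun x y => by
    rw [hT, ← hψ.neg_eq, ← hT, hφ.neg_eq]
  have hpow : ∀ n : ℕ, φ.IsSelfAdjoint ⇑(T ^ n) := fun n => by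
    induction n with
    | zero => exact LinearMap.isAdjointPair_one
    | succ n ih =>
      have hmul := LinearMap.IsAdjointPair.mul hself ih
      rwa [← pow_succ, ← pow_succ'] at hmul
  rw [← LinearMap.mem_selfAdjointSubmodule, aeval_eq_sum_range]
  exact Submodule.sum_mem _ fun n _ => Submodule.smul_mem _ _ (hpow n)

theorem apply_aeval_self (hφ : φ.IsAlt) (hψ : ψ.IsAlt) (hT : ∀ x, φ (T x) = ψ x) (p : k[X])
    (x : V) : φ (aeval T p x) x = 0 := by
  have hpow : ∀ n, φ ((T ^ n) x) x = 0 := fun n =>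
    (isotropic_of_sequence hψ hφ (u := fun n => (T ^ n) x) (n := n)
      (fun j _ => by rw [pow_succ', Module.End.mul_apply, hT]) le_rfl n.zero_le).2
  simp [aeval_eq_sum_range, LinearMap.sum_apply, hpow]

theorem aeval_eq_zero_or_aeval_eq_zero_of_isCoprime (hφ : φ.IsAlt) (hψ : ψ.IsAlt)
    (hT : ∀ x, φ (T x) = ψ x) (hind : OrthogonallyIndecomposable φ ψ) {f g : k[X]}
    (hfg : IsCoprime f g) (hzero : aeval T (f * g) = 0) : aeval T f = 0 ∨ aeval T g = 0 := by
  have hcompl : IsCompl (LinearMap.ker (aeval T f)) (LinearMap.ker (aeval T g)) := by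
    refine ⟨disjoint_ker_aeval_of_isCoprime T hfg, codisjoint_iff.mpr ?_⟩
    rw [sup_ker_aeval_eq_ker_aeval_mul_of_coprime T hfg, hzero, LinearMap.ker_zero]
  have hφ_orth : ∀ x ∈ LinearMap.ker (aeval T f), ∀ y ∈ LinearMap.ker (aeval T g),
      φ x y = 0 := by
    intro x hx y hy
    rw [LinearMap.mem_ker] at hx hy
    obtain ⟨u, v, huv⟩ := hfg
    have hx' : aeval T g (aeval T v x) = x := by
      have hadd := LinearMap.congr_fun (congrArg (aeval T) huv) x
      rwa [mul_comm v, map_add, map_mul, map_mul, map_one, LinearMap.add_apply,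
        Module.End.mul_apply, Module.End.mul_apply, hx, map_zero, zero_add] at hadd
    rw [← hx', isSelfAdjoint_aeval hφ hψ hT, hy, map_zero]
  have hTker : ∀ x ∈ LinearMap.ker (aeval T f), T x ∈ LinearMap.ker (aeval T f) := by
    intro x hx
    rw [LinearMap.mem_ker] at hx ⊢
    have hcomm := LinearMap.congr_fun (congrArg (aeval T) (mul_comm f X)) x
    rwa [map_mul, map_mul, aeval_X, Module.End.mul_apply, Module.End.mul_apply, hx, map_zero]
      at hcomm
  rcases hind _ _ hcompl fun x hx y hy =>
    ⟨hφ_orth x hx y hy, by rw [← hT]; exact hφ_orth _ (hTker x hx) y hy⟩ with hf | hg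
  · right
    exact LinearMap.ker_eq_top.mp (eq_top_of_bot_isCompl (hf ▸ hcompl))
  · left
    exact LinearMap.ker_eq_top.mp (eq_top_of_isCompl_bot (hg ▸ hcompl))

variable {a : k[X]}

/-- Along `s`, the forms are those of the Heisenberg group over `k[x]/(a)` modulo the kernel of
`r ↦ (l r, l (x r))`: `φ` is the determinant followed by `l`, and `ψ` is `φ` twisted by `x`. -/
structure IsSlopedPair (φ ψ : LinearMap.BilinForm k V) (l : AdjoinRoot a →ₗ[k] k)
    (s : (AdjoinRoot a × AdjoinRoot a) →ₗ[k] V) : Prop where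
  nondegenerate : ∀ r, (∀ t, l (t * r) = 0) → r = 0
  left_apply : ∀ x y, φ (s x) (s y) = l (x.1 * y.2 - y.1 * x.2)
  right_apply : ∀ x, ψ (s x) = φ (s (AdjoinRoot.root a • x))

/-- The quotient map `r ↦ (l r, l (x r))` of the Heisenberg group's center `k[x]/(a)`. -/
noncomputable def slopedMap (l : AdjoinRoot a →ₗ[k] k) : AdjoinRoot a →ₗ[k] (Fin 2 → k) :=
  LinearMap.pi ![l, l ∘ₗ LinearMap.mulLeft k (AdjoinRoot.root a)]

theorem slopedMap_apply (l : AdjoinRoot a →ₗ[k] k) (r : AdjoinRoot a) :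
    slopedMap l r = ![l r, l (AdjoinRoot.root a * r)] := by
  ext i
  fin_cases i <;> rfl

theorem isSlopedPair_of_algHom (hφ : φ.IsAlt) (hψ : ψ.IsAlt) (ρ : AdjoinRoot a →ₐ[k] End k V)
    (hρ : ∀ x, φ (ρ (AdjoinRoot.root a) x) = ψ x) {v w : V}
    (hnd : ∀ r, (∀ t, φ (ρ (t * r) v) w = 0) → r = 0) :
    IsSlopedPair φ ψ (φ.flip w ∘ₗ LinearMap.applyₗ v ∘ₗ ρ.toLinearMap)
      ((LinearMap.applyₗ v ∘ₗ ρ.toLinearMap).coprod (LinearMap.applyₗ w ∘ₗ ρ.toLinearMap)) := by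
  have hmk : ∀ p, ρ (AdjoinRoot.mk a p) = aeval (ρ (AdjoinRoot.root a)) p := fun p => by
    rw [aeval_algHom_apply, AdjoinRoot.aeval_eq]
  have hadj : ∀ r t x y, φ (ρ r x) (ρ t y) = φ (ρ (r * t) x) y := fun r t x y => by
    obtain ⟨p, rfl⟩ := AdjoinRoot.mk_surjective t
    rw [mul_comm, map_mul, Module.End.mul_apply, hmk, isSelfAdjoint_aeval hφ hψ hρ]
  have hself : ∀ r t x, φ (ρ r x) (ρ t x) = 0 := fun r t x => by
    obtain ⟨p, hp⟩ := AdjoinRoot.mk_surjective (r * t)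
    rw [hadj, ← hp, hmk, apply_aeval_self hφ hψ hρ]
  refine ⟨hnd, fun x y => ?_, fun x => ?_⟩
  · simp only [LinearMap.coprod_apply, LinearMap.comp_apply, LinearMap.applyₗ_apply_apply,
      AlgHom.toLinearMap_apply]
    rw [apply_add_add_of_isotropic hφ (hself _ _ _) (hself _ _ _), hadj, hadj,
      ← LinearMap.sub_apply, ← map_sub, ← LinearMap.sub_apply, ← map_sub]
    rfl
  · simp [← hρ]

theorem exists_isSlopedPair (hφ : φ.IsAlt) (hψ : ψ.IsAlt) (hnd : φ.Nondegenerate) {T : End k V}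
    (hT : ∀ x, φ (T x) = ψ x) (ha : Irreducible a) {c : ℕ} (hzero : aeval T (a ^ (c + 1)) = 0)
    (hne : aeval T (a ^ c) ≠ 0) :
    ∃ (l : AdjoinRoot (a ^ (c + 1)) →ₗ[k] k) (s : _ →ₗ[k] V), IsSlopedPair φ ψ l s := by
  let ρ : AdjoinRoot (a ^ (c + 1)) →ₐ[k] End k V :=
    Ideal.Quotient.liftₐ (Ideal.span {a ^ (c + 1)}) (aeval T) fun q hq => by
      obtain ⟨r, rfl⟩ := Ideal.mem_span_singleton.mp hq
      rw [map_mul, hzero, zero_mul]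
  have hρ : ∀ p, ρ (AdjoinRoot.mk _ p) = aeval T p := fun _ => rfl
  obtain ⟨v, hv⟩ := DFunLike.ne_iff.mp hne
  obtain ⟨w, hw⟩ : ∃ w, φ (aeval T (a ^ c) v) w ≠ 0 := by
    by_contra! hall
    exact hv (hnd.1 _ hall)
  refine ⟨_, _, isSlopedPair_of_algHom hφ hψ ρ (fun x => ?_) (v := v) (w := w) fun r hr => ?_⟩
  · rw [← hT, AdjoinRoot.root, hρ, aeval_X]
  · by_contra hr0
    obtain ⟨t, ht⟩ := exists_mul_eq_mk_pow ha hr0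
    exact hw (by rw [← hρ, ← ht, hr])

namespace IsSlopedPair

variable {l : AdjoinRoot a →ₗ[k] k} {s : (AdjoinRoot a × AdjoinRoot a) →ₗ[k] V}

theorem apply_apply (h : IsSlopedPair φ ψ l s) (x y : AdjoinRoot a × AdjoinRoot a) :
    ![φ (s x) (s y), ψ (s x) (s y)] =
      heisenbergBracket (AddMonoidHom.mul.compr₂ (slopedMap l).toAddMonoidHom) x y := by
  have hroot : ψ (s x) (s y) = l (AdjoinRoot.root a * (x.1 * y.2 - y.1 * x.2)) := by
    rw [h.right_apply, h.left_apply]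
    congr 1
    simp only [Prod.smul_fst, Prod.smul_snd, smul_eq_mul]
    ring
  rw [h.left_apply, hroot, ← slopedMap_apply]
  exact map_sub (slopedMap l) _ _

theorem bijective [FiniteDimensional k V] (h : IsSlopedPair φ ψ l s)
    (hind : OrthogonallyIndecomposable φ ψ) (ha : 0 < a.degree) :
    Function.Bijective s := by
  have := (AdjoinRoot.powerBasis (ne_zero_of_degree_gt ha)).finite
  have := AdjoinRoot.nontrivial a ha.ne'
  refine hind.bijective s (fun x hx => ?_) (φ ∘ₗ s).flip Subspace.dual_finrank_eq.le
    fun y hy x => ?_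
  · refine Prod.ext (h.nondegenerate _ fun t => ?_) (h.nondegenerate _ fun t => ?_)
    · simpa [h.left_apply, mul_comm] using (hx (0, t)).1
    · simpa [h.left_apply] using (hx (t, 0)).1
  · rw [h.right_apply]
    exact ⟨LinearMap.congr_fun hy x, LinearMap.congr_fun hy _⟩

end IsSlopedPair

end Sloped

end Pencil

section Main

open Module

variable {k V G : Type*} [Field k] [AddCommGroup V] [Module k V] [Group G]
  {φ ψ : LinearMap.BilinForm k V}

namespace HasCommutation

theorem isAlt (hB : HasCommutation G fun x y => ![φ x y, ψ x y]) : φ.IsAlt ∧ ψ.IsAlt :=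
  ⟨fun v => congrFun (hB.self_eq_zero v) 0, fun v => congrFun (hB.self_eq_zero v) 1⟩

theorem disjoint_ker (hB : HasCommutation G fun x y => ![φ x y, ψ x y]) :
    Disjoint (LinearMap.ker φ) (LinearMap.ker ψ) :=
  Submodule.disjoint_def.mpr fun x hφ hψ => hB.eq_zero_of_forall fun y => by
    simp [LinearMap.mem_ker.mp hφ, LinearMap.mem_ker.mp hψ]

theorem orthogonallyIndecomposable (hB : HasCommutation G fun x y => ![φ x y, ψ x y])
    (hG : IsCentrallyIndecomposable G) : OrthogonallyIndecomposable φ ψ := by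
  intro P Q hPQ horth
  have hcompl : IsCompl P.toAddSubgroup Q.toAddSubgroup := by
    refine ⟨disjoint_iff.mpr ?_, codisjoint_iff.mpr ?_⟩
    · exact (congrArg Submodule.toAddSubgroup hPQ.inf_eq_bot).trans Submodule.bot_toAddSubgroup
    · rw [← Submodule.sup_toAddSubgroup, hPQ.sup_eq_top, Submodule.top_toAddSubgroup]
  refine (hB.eq_bot_or_eq_bot_of_isCompl hG hcompl fun x hx y hy => ?_).imp
    (fun h => Submodule.toAddSubgroup_injective h) fun h => Submodule.toAddSubgroup_injective h
  simp [horth x hx y hy]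

theorem swap (hB : HasCommutation G fun x y => ![φ x y, ψ x y]) :
    HasCommutation G fun x y => ![ψ x y, φ x y] :=
  hB.congr (.refl V) (LinearEquiv.funCongrLeft k k (Equiv.swap 0 1)).toAddEquiv fun x y => by
    ext i
    fin_cases i <;> rfl

end HasCommutation

theorem IsSlopedPair.isoclinic {a : k[X]} {l : AdjoinRoot a →ₗ[k] k}
    {s : (AdjoinRoot a × AdjoinRoot a) →ₗ[k] V} (h : IsSlopedPair φ ψ l s)
    (hs : Function.Bijective s) (hB : HasCommutation G fun x y => ![φ x y, ψ x y]) :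
    Function.Surjective (slopedMap l) ∧
      Isoclinic G (heisenberg (AdjoinRoot a) ⧸
        heisenbergCentral (LinearMap.ker (slopedMap l)).toAddSubgroup) := by
  have hbracket : HasCommutation G
      (heisenbergBracket (AddMonoidHom.mul.compr₂ (slopedMap l).toAddMonoidHom)) :=
    hB.congr (LinearEquiv.ofBijective s hs).toAddEquiv (.refl _) h.apply_apply
  have hsurj : Function.Surjective (slopedMap l) :=
    AddMonoidHom.range_eq_top.mp <| hbracket.eq_top_of_forall_mem
      (S := (slopedMap l).toAddMonoidHom.range) fun x y =>
        ⟨x.1 * y.2 - y.1 * x.2, map_sub (slopedMap l) _ _⟩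
  refine ⟨hsurj, ?_⟩
  rw [LinearMap.ker_toAddSubgroup]
  refine hbracket.isoclinic (hasCommutation_heisenberg_quotient _ hsurj fun r hr => ?_)
  exact h.nondegenerate r fun t => by simpa [slopedMap_apply] using congrFun (hr t) 0

theorem exists_isoclinic_heisenberg_quotient [FiniteDimensional k V]
    (hG : IsCentrallyIndecomposable G) (hB : HasCommutation G fun x y => ![φ x y, ψ x y])
    (hφ : φ.Nondegenerate) :
    ∃ (a : k[X]) (c : ℕ) (L : Submodule k (AdjoinRoot (a ^ c))),
      Irreducible a ∧ 0 < c ∧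
      finrank k (AdjoinRoot (a ^ c)) = c * a.natDegree ∧
      finrank k (AdjoinRoot (a ^ c) ⧸ L) = 2 ∧
      heisenbergCentral L.toAddSubgroup ≤ commutator (heisenberg (AdjoinRoot (a ^ c))) ∧
      Isoclinic G (heisenberg (AdjoinRoot (a ^ c)) ⧸ heisenbergCentral L.toAddSubgroup) := by
  have hind := hB.orthogonallyIndecomposable hG
  obtain ⟨hφ_alt, hψ_alt⟩ := hB.isAlt
  have := hB.nontrivial
  have hT : ∀ x, φ (ψ.symmCompOfNondegenerate φ hφ x) = ψ x := fun x =>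
    LinearMap.ext fun y => ψ.symmCompOfNondegenerate_left_apply hφ y x
  obtain ⟨a, c, ha, hzero, hne⟩ := exists_aeval_irreducible_pow_eq_zero
    (Algebra.IsIntegral.isIntegral _) fun f g =>
      aeval_eq_zero_or_aeval_eq_zero_of_isCoprime hφ_alt hψ_alt hT hind
  have hpow : a ^ (c + 1) ≠ 0 := pow_ne_zero _ ha.ne_zero
  obtain ⟨l, s, h⟩ := exists_isSlopedPair hφ_alt hψ_alt hφ hT ha hzero hne
  have hdeg : 0 < (a ^ (c + 1)).degree := degree_pos_of_ne_zero_of_nonunit hpow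
    fun h => ha.not_isUnit ((isUnit_pow_iff c.succ_ne_zero).mp h)
  obtain ⟨hsurj, hiso⟩ := h.isoclinic (h.bijective hind hdeg) hB
  refine ⟨a, c + 1, LinearMap.ker (slopedMap l), ha, c.succ_pos, ?_, ?_,
    heisenbergCentral_le_commutator _, hiso⟩
  · rw [(AdjoinRoot.powerBasis hpow).finrank, AdjoinRoot.powerBasis_dim, natDegree_pow]
  · rw [((slopedMap l).quotKerEquivOfSurjective hsurj).finrank_eq, finrank_fin_fun]

theorem IsKroneckerPair.isoclinic [FiniteDimensional k V] {m : ℕ} {v w : ℕ → V}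
    (h : IsKroneckerPair φ ψ m v w) (hG : IsCentrallyIndecomposable G)
    (hB : HasCommutation G fun x y => ![φ x y, ψ x y]) : Isoclinic G (flatGroup k (m + 1)) := by
  obtain ⟨hφ, hψ⟩ := hB.isAlt
  have hbij := h.kroneckerMap_bijective hφ hψ (hB.orthogonallyIndecomposable hG)
  exact (hB.congr (LinearEquiv.ofBijective _ hbij).toAddEquiv (.refl _)
    (h.apply_kroneckerMap hφ hψ)).isoclinic (hasCommutation_flatGroup k m)

end Main

theorem theorem1p2_general (k : Type*) [Field k] (G : Type*) [Group G]
    (hG : IsCentrallyIndecomposable G) (hk : HasGenusTwoOver k G) :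
    (∃ (a : k[X]) (c : ℕ) (L : Submodule k (AdjoinRoot (a ^ c))),
      Irreducible a ∧ 0 < c ∧
      Module.finrank k (AdjoinRoot (a ^ c)) = c * a.natDegree ∧
      Module.finrank k (AdjoinRoot (a ^ c) ⧸ L) = 2 ∧
      heisenbergCentral L.toAddSubgroup ≤ commutator (heisenberg (AdjoinRoot (a ^ c))) ∧
      Isoclinic G (heisenberg (AdjoinRoot (a ^ c)) ⧸ heisenbergCentral L.toAddSubgroup)) ∨
    (∃ m : ℕ, 0 < m ∧ Isoclinic G (flatGroup k m)) := by
  obtain ⟨d, φ, ψ, hB⟩ := hk.exists_hasCommutation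
  obtain ⟨hφ, hψ⟩ := hB.isAlt
  by_cases hreg : PencilRegular φ ψ
  · left
    rcases hreg.nondegenerate_or_nondegenerate hφ hψ (hB.orthogonallyIndecomposable hG) with h | h
    · exact exists_isoclinic_heisenberg_quotient hG hB h
    · exact exists_isoclinic_heisenberg_quotient hG hB.swap h
  · right
    obtain ⟨m, v, w, h⟩ := exists_isKroneckerPair hφ hψ hB.disjoint_ker hreg
    exact ⟨m + 1, m.succ_pos, h.isoclinic hG hB⟩

theorem theorem1p2 (p : ℕ) [Fact p.Prime] (k : Type*) [Field k] (G : Type*) [Group G]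
    (hp : IsPGroup p G) (hG : IsCentrallyIndecomposable G) (hk : HasGenusTwoOver k G) :
    (∃ (a : k[X]) (c : ℕ) (L : Submodule k (AdjoinRoot (a ^ c))),
      Irreducible a ∧ 0 < c ∧
      Module.finrank k (AdjoinRoot (a ^ c)) = c * a.natDegree ∧
      Module.finrank k (AdjoinRoot (a ^ c) ⧸ L) = 2 ∧
      heisenbergCentral L.toAddSubgroup ≤ commutator (heisenberg (AdjoinRoot (a ^ c))) ∧
      Isoclinic G (heisenberg (AdjoinRoot (a ^ c)) ⧸ heisenbergCentral L.toAddSubgroup)) ∨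
    (∃ m : ℕ, 0 < m ∧ Isoclinic G (flatGroup k m)) :=
  theorem1p2_general k G hG hk
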